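/- **Definitions.** For $z\in[0,1)$ let $y=\phi_z(x)$, $x>0$, be the positive solution of $$\frac{dy}{dx}=1-\frac{2z}{y}+\frac1{y^2},\qquad y(0^+)=0 ,$$ so that $\phi_z:(0,\infty)\to(0,\infty)$ is a bijection with inverse $$\phi_z^{-1}(y)=\int_0^y\frac{s^2}{s^2-2zs+1}\,ds .$$ Let $$w(x,y,z)=\Big(-\tfrac{6z}{y^4}+\tfrac{8+28z^2}{y^5}-\tfrac{52z+32z^3}{y^6}+\tfrac{20+76z^2}{y^7}-\tfrac{54z}{y^8}+\tfrac{12}{y^9}\Big)x^3+\Big(\tfrac{2z}{y^3}-\tfrac{2+4z^2}{y^4}+\tfrac{6z}{y^5}-\tfrac{2}{y^6}\Big)x^2 ,$$ and define $j_z:[0,\infty)\to\mathbb R$ by $j_z(y)=w(\phi_z^{-1}(y),y,z)$ for $y>0$ and $j_z(0)=\tfrac29$. For real $m,e$ with $0\le m<|e|$ (super-extremal Reissner–Nordström of mass $m$ and charge $e$) let $\rho(r)$, $r>0$, be the area radius as a function of the tortoise coordinate, i.e. the positive solution of $$\frac{d\rho}{dr}=1-\frac{2m}{\rho}+\frac{e^2}{\rho^2},\qquad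 \rho(0^+)=0,$$ and let $V(r)=\rho''(r)/\rho(r)$. **Proposition.** 1. For every $0\le z\le\frac12$, the function $j_z$ is continuous (from the right) at $y=0$, it has a local maximum on $[0,\infty)$ at $y=0$, and it has no other local maximum on $[0,\infty)$ (not even a non-strict one). 2. Let $0\le m<|e|$ and $|e|\ge 2m$. Then $r\mapsto rV(r)$ is differentiable on $(0,\infty)$ and $$\sup_{r>0}\; r^2\frac{d}{dr}\big(rV(r)\big)=\frac29<\frac14 .$$ -/

import Mathlib

open Set Filter Topology

namespace ReissnerNordstrom

noncomputable section

/-- The metric coefficient `α² = 1 - 2m/ρ + e²/ρ²`. -/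
def alphaSq (m e ρ : ℝ) : ℝ := 1 - 2 * m / ρ + e ^ 2 / ρ ^ 2

/-- The tortoise coordinate as a function of the area radius, normalized to vanish at `ρ = 0`:
the integral of `dr = α⁻² dρ`, where `α⁻² = ρ² / (ρ² - 2mρ + e²)`. -/
def tortoise (m e ρ : ℝ) : ℝ := ∫ s in (0 : ℝ)..ρ, s ^ 2 / (s ^ 2 - 2 * m * s + e ^ 2)

/-- The area radius `ρ` as a function of the tortoise coordinate `r > 0`: the inverse of
`tortoise m e : (0,∞) → (0,∞)`. By `areaRadius_spec` and `areaRadius_unique` it is the unique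
positive solution on `(0,∞)` of `dρ/dr = α²` with `ρ(0+) = 0`. The function
`φ_z` is `areaRadius z 1`. -/
def areaRadius (m e r : ℝ) : ℝ := Function.invFunOn (tortoise m e) (Ioi 0) r

/-- The potential `V = ρ'' / ρ`. -/
def V (m e r : ℝ) : ℝ := deriv (deriv (areaRadius m e)) r / areaRadius m e r

/-- The function `w(x,y,z)`, obtained from `x² d/dx (x v(φ_z(x), z))`, with
`v = y⁻¹ d²y/dx²`, by treating `x` and `y = φ_z(x)` as independent variables. -/
def w (x y z : ℝ) : ℝ :=
  (-(6 * z / y ^ 4) + (8 + 28 * z ^ 2) / y ^ 5 - (52 * z + 32 * z ^ 3) / y ^ 6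
    + (20 + 76 * z ^ 2) / y ^ 7 - 54 * z / y ^ 8 + 12 / y ^ 9) * x ^ 3
  + (2 * z / y ^ 3 - (2 + 4 * z ^ 2) / y ^ 4 + 6 * z / y ^ 5 - 2 / y ^ 6) * x ^ 2

/-- `j_z(y) = w(φ_z⁻¹(y), y, z)` for `y > 0`, where `φ_z⁻¹ = tortoise z 1`, and
`j_z(0) = 2/9` (the limit at `y = 0+`). Only its values on `[0,∞)` matter. -/
def j (z y : ℝ) : ℝ := if y = 0 then 2 / 9 else w (tortoise z 1 y) y z

theorem quad_pos {m e : ℝ} (h : |m| < |e|) (s : ℝ) : 0 < s ^ 2 - 2 * m * s + e ^ 2 := by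
  have := sq_lt_sq.2 h
  nlinarith [sq_nonneg (s - m)]

theorem continuous_integrand {m e : ℝ} (h : |m| < |e|) :
    Continuous fun s : ℝ => s ^ 2 / (s ^ 2 - 2 * m * s + e ^ 2) :=
  Continuous.div (by fun_prop) (by fun_prop) fun s => (quad_pos h s).ne'

theorem alphaSq_inv {m e ρ : ℝ} (hρ : ρ ≠ 0) :
    (alphaSq m e ρ)⁻¹ = ρ ^ 2 / (ρ ^ 2 - 2 * m * ρ + e ^ 2) := by
  have : alphaSq m e ρ = (ρ ^ 2 - 2 * m * ρ + e ^ 2) / ρ ^ 2 := by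
    unfold alphaSq; field_simp
  rw [this, inv_div]

theorem tortoise_zero (m e : ℝ) : tortoise m e 0 = 0 := by simp [tortoise]

theorem hasDerivAt_tortoise {m e : ℝ} (h : |m| < |e|) (ρ : ℝ) :
    HasDerivAt (tortoise m e) (ρ ^ 2 / (ρ ^ 2 - 2 * m * ρ + e ^ 2)) ρ :=
  (continuous_integrand h).integral_hasStrictDerivAt 0 ρ |>.hasDerivAt

theorem continuous_tortoise {m e : ℝ} (h : |m| < |e|) : Continuous (tortoise m e) :=
  continuous_iff_continuousAt.2 fun ρ => (hasDerivAt_tortoise h ρ).continuousAt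

theorem strictMonoOn_tortoise {m e : ℝ} (h : |m| < |e|) :
    StrictMonoOn (tortoise m e) (Ici 0) := by
  refine strictMonoOn_of_deriv_pos (convex_Ici 0) (continuous_tortoise h).continuousOn ?_
  intro x hx
  rw [interior_Ici] at hx
  rw [(hasDerivAt_tortoise h x).deriv]
  exact div_pos (pow_pos hx 2) (quad_pos h x)

theorem tortoise_lower {m e : ℝ} (h : |m| < |e|) {ρ : ℝ} (hρ : |e| ≤ ρ) :
    (ρ - |e|) / 4 ≤ tortoise m e ρ := by
  have hmono : MonotoneOn (fun s => tortoise m e s - s / 4) (Ici |e|) := by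
    refine monotoneOn_of_deriv_nonneg (convex_Ici _)
      ((continuous_tortoise h).sub (by fun_prop)).continuousOn
      (fun x _ => ((hasDerivAt_tortoise h x).sub
        ((hasDerivAt_id x).div_const 4)).differentiableAt.differentiableWithinAt) ?_
    intro x hx
    rw [interior_Ici] at hx
    have hd : HasDerivAt (fun s => tortoise m e s - s / 4)
        (x ^ 2 / (x ^ 2 - 2 * m * x + e ^ 2) - 1 / 4) x :=
      (hasDerivAt_tortoise h x).sub ((hasDerivAt_id x).div_const 4)
    rw [hd.deriv]
    have hx' : |e| < x := hx
    have he := abs_nonneg e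
    have h1 := neg_abs_le m
    have h2 : e ^ 2 = |e| ^ 2 := (sq_abs e).symm
    have : 1 / 4 ≤ x ^ 2 / (x ^ 2 - 2 * m * x + e ^ 2) := by
      rw [le_div_iff₀ (quad_pos h x)]
      nlinarith [mul_nonneg (he.trans hx'.le) (by linarith : 0 ≤ x + m)]
    linarith
  have h0 : 0 ≤ tortoise m e |e| := by
    rw [← tortoise_zero m e]
    exact (strictMonoOn_tortoise h).monotoneOn (mem_Ici.2 le_rfl) (mem_Ici.2 (abs_nonneg e))
      (abs_nonneg e)
  have := hmono (mem_Ici.2 le_rfl) (mem_Ici.2 hρ) hρ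
  simp only at this
  linarith

theorem tortoise_bijOn {m e : ℝ} (h : |m| < |e|) :
    BijOn (tortoise m e) (Ioi 0) (Ioi 0) := by
  refine ⟨fun x hx => ?_, ((strictMonoOn_tortoise h).mono Ioi_subset_Ici_self).injOn, ?_⟩
  · rw [mem_Ioi, ← tortoise_zero m e]
    exact strictMonoOn_tortoise h (mem_Ici.2 le_rfl) (mem_Ici.2 (le_of_lt hx)) hx
  · intro r hr
    have hr' : 0 < r := hr
    have he := abs_nonneg e
    have hb : r ≤ tortoise m e (|e| + 4 * r) := by
      have := tortoise_lower h (ρ := |e| + 4 * r) (by linarith)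
      linarith
    obtain ⟨x, hx, hxr⟩ := intermediate_value_Icc (by linarith : (0 : ℝ) ≤ |e| + 4 * r)
      (continuous_tortoise h).continuousOn ⟨(tortoise_zero m e).trans_le hr'.le, hb⟩
    refine ⟨x, lt_of_le_of_ne hx.1 ?_, hxr⟩
    rintro rfl
    rw [tortoise_zero] at hxr
    exact hr'.ne hxr

theorem areaRadius_pos {m e : ℝ} (h : |m| < |e|) {r : ℝ} (hr : 0 < r) :
    0 < areaRadius m e r :=
  Function.invFunOn_mem ((tortoise_bijOn h).surjOn hr)

theorem tortoise_areaRadius {m e : ℝ} (h : |m| < |e|) {r : ℝ} (hr : 0 < r) :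
    tortoise m e (areaRadius m e r) = r :=
  Function.invFunOn_eq ((tortoise_bijOn h).surjOn hr)

theorem areaRadius_tortoise {m e : ℝ} (h : |m| < |e|) {ρ : ℝ} (hρ : 0 < ρ) :
    areaRadius m e (tortoise m e ρ) = ρ :=
  (tortoise_bijOn h).injOn (areaRadius_pos h ((tortoise_bijOn h).mapsTo hρ)) hρ
    (tortoise_areaRadius h ((tortoise_bijOn h).mapsTo hρ))

theorem areaRadius_lt {m e : ℝ} (h : |m| < |e|) {r ρ : ℝ} (hr : 0 < r) (hρ : 0 < ρ) :
    areaRadius m e r < ρ ↔ r < tortoise m e ρ := by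
  rw [← (strictMonoOn_tortoise h).lt_iff_lt (areaRadius_pos h hr).le hρ.le,
    tortoise_areaRadius h hr]

theorem lt_areaRadius {m e : ℝ} (h : |m| < |e|) {r ρ : ℝ} (hr : 0 < r) (hρ : 0 < ρ) :
    ρ < areaRadius m e r ↔ tortoise m e ρ < r := by
  rw [← (strictMonoOn_tortoise h).lt_iff_lt hρ.le (areaRadius_pos h hr).le,
    tortoise_areaRadius h hr]

/-- `areaRadius m e` solves `dρ/dr = α²`, `ρ(0+) = 0`. -/
theorem areaRadius_spec {m e : ℝ} (h : |m| < |e|) :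
    (∀ r, 0 < r → 0 < areaRadius m e r ∧
      HasDerivAt (areaRadius m e) (alphaSq m e (areaRadius m e r)) r) ∧
    Tendsto (areaRadius m e) (𝓝[>] 0) (𝓝 0) := by
  refine ⟨fun r hr => ⟨areaRadius_pos h hr, ?_⟩, ?_⟩
  · have hp := areaRadius_pos h hr
    have hc : ContinuousAt (areaRadius m e) r := by
      refine tendsto_order.2 ⟨fun a ha => ?_, fun b hb => ?_⟩
      · by_cases ha0 : 0 < a
        · filter_upwards [lt_mem_nhds hr, lt_mem_nhds ((lt_areaRadius h hr ha0).1 ha)]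
            with x hx hx'
          exact (lt_areaRadius h hx ha0).2 hx'
        · filter_upwards [lt_mem_nhds hr] with x hx
          exact (not_lt.1 ha0).trans_lt (areaRadius_pos h hx)
      · have hb0 := hp.trans hb
        filter_upwards [lt_mem_nhds hr, gt_mem_nhds ((areaRadius_lt h hr hb0).1 hb)]
          with x hx hx'
        exact (areaRadius_lt h hx hb0).2 hx'
    have hd := hasDerivAt_tortoise h (areaRadius m e r)
    rw [← alphaSq_inv hp.ne'] at hd
    have hne : (alphaSq m e (areaRadius m e r))⁻¹ ≠ 0 := by
      rw [alphaSq_inv hp.ne']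
      exact (div_pos (pow_pos hp 2) (quad_pos h _)).ne'
    have := hd.of_local_left_inverse hc hne
      (by filter_upwards [lt_mem_nhds hr] with x hx using tortoise_areaRadius h hx)
    rwa [inv_inv] at this
  · refine tendsto_order.2 ⟨fun a ha => ?_, fun b hb => ?_⟩
    · filter_upwards [self_mem_nhdsWithin] with x hx
      exact ha.trans (areaRadius_pos h hx)
    · have : 0 < tortoise m e b := (tortoise_bijOn h).mapsTo hb
      filter_upwards [self_mem_nhdsWithin, mem_nhdsWithin_of_mem_nhds (gt_mem_nhds this)]
        with x hx hx'
      exact (areaRadius_lt h hx hb).2 hx'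

/-- `areaRadius m e` is the only positive solution of `dρ/dr = α²`, `ρ(0+) = 0`. -/
theorem areaRadius_unique {m e : ℝ} (h : |m| < |e|) {σ : ℝ → ℝ}
    (hσ : ∀ r, 0 < r → 0 < σ r ∧ HasDerivAt σ (alphaSq m e (σ r)) r)
    (h0 : Tendsto σ (𝓝[>] 0) (𝓝 0)) {r : ℝ} (hr : 0 < r) : σ r = areaRadius m e r := by
  have hder : ∀ x ∈ Ioi (0 : ℝ), HasDerivAt (fun s => tortoise m e (σ s) - s) 0 x := by
    intro x hx
    obtain ⟨hp, hd⟩ := hσ x hx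
    have h1 := hasDerivAt_tortoise h (σ x)
    rw [← alphaSq_inv hp.ne'] at h1
    have hne : alphaSq m e (σ x) ≠ 0 := by
      rw [ne_eq, ← inv_eq_zero, alphaSq_inv hp.ne']
      exact (div_pos (pow_pos hp 2) (quad_pos h _)).ne'
    have h2 := (h1.comp x hd).sub (hasDerivAt_id x)
    rw [inv_mul_cancel₀ hne, sub_self] at h2
    exact h2
  have hconst : ∀ x ∈ Ioi (0 : ℝ), tortoise m e (σ x) - x = tortoise m e (σ r) - r := by
    intro x hx
    exact isOpen_Ioi.is_const_of_deriv_eq_zero (convex_Ioi (0 : ℝ)).isPreconnected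
      (fun y hy => (hder y hy).differentiableAt.differentiableWithinAt)
      (fun y hy => (hder y hy).deriv) hx hr
  have hlim : Tendsto (fun s => tortoise m e (σ s) - s) (𝓝[>] 0) (𝓝 (tortoise m e 0 - 0)) :=
    (((continuous_tortoise h).tendsto 0).comp h0).sub
      (tendsto_id.mono_left nhdsWithin_le_nhds)
  have hlim' : Tendsto (fun s => tortoise m e (σ s) - s) (𝓝[>] 0)
      (𝓝 (tortoise m e (σ r) - r)) :=
    tendsto_const_nhds.congr' (by
      filter_upwards [self_mem_nhdsWithin] with x hx using (hconst x hx).symm)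
  have := tendsto_nhds_unique hlim hlim'
  rw [tortoise_zero] at this
  have hr2 : tortoise m e (σ r) = r := by linarith
  rw [← areaRadius_tortoise h (hσ r hr).1, hr2]

end

end ReissnerNordstrom

/-!
Write `v = y'' / y` along the solution `y = φ_z(x)` and regard everything as a function of `y`, with
`x = φ_z⁻¹(y)`, `q = y ^ 2 - 2 z y + 1` and `u = x / y ^ 3`. Then `j_z = x² (x v)'` and
`dj_z/dx = x (x² v)''`, so the task is to show that `x² v` changes from concave to convex at most
once. There are polynomials `b`, `c`, `d`, `e` in `y`, `z` with `v = 2 b q / y ^ 6` and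
derivatives `2 c q / y ^ 9`, `2 d q / y ^ 12`, `2 e q / y ^ 15`; hence `(x² v)''` has the sign of
the quadratic `Q = d u² + 4 c u + 2 b`, and where it vanishes its derivative has the sign of
`R = e u² + 6 d u + 6 c`.

The transcendental function `u` is dealt with as follows. Let `M = d u + 2 c` be half the slope of
the quadratic at `u`. If `Q = 0`, then `R` and `M` have the same strict sign, as soon as a certain
discriminant of `b`, `c`, `d`, `e` is positive (`mul_pos_of_cubicDisc_pos`). This discriminant is a
polynomial in `y` and `z` which is positive for `y > 0`, `0 ≤ z ≤ 1 / 2` (`cubicDisc_coeff_pos`), by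
sums of squares. Its positivity also gives the quadratic two distinct real roots. A rational lower
bound for `φ_z⁻¹` (`tortoise_lower_barrier`) shows that `M < 0` where `d ≤ 0`, so that `Q < 0`
wherever `M = 0`, and that `Q < 0` for small `y` (`eventually_critQ_neg`). A continuity
argument (`deriv_pos_of_zero`) now shows that `(x² v)''` has positive derivative at each of its
zeros: otherwise, going back from such a zero to the start of the preceding interval where `Q > 0`,
`M` would vanish inside that interval. So every critical point of `j_z` in `(0, ∞)` is a strict
local minimum.

As `j_z` is continuous on `[0, ∞)` and tends to `0` at infinity, its maximum is `j_z(0) = 2 / 9`.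
By scaling, `r² d/dr (r V(r)) = j_z(ρ(r) / |e|)` with `z = m / |e|` (`hasDerivAt_mul_V`), which gives
the statement on the potential.
-/

namespace ReissnerNordstrom

/-! ### The discriminant -/

/-- The coefficient `b` of `v = 2 b q / y ^ 6`, where `v = y'' / y` along a solution `y = φ_z(x)`
and `q = y ^ 2 - 2 z y + 1`. -/
noncomputable def coeffB (z y : ℝ) : ℝ := z * y - 1

/-- The coefficient `c` of `dv/dx = 2 c q / y ^ 9`. -/
noncomputable def coeffC (z y : ℝ) : ℝ :=
  6 - 15 * (z * y) + 8 * (z * y) ^ 2 + 4 * y ^ 2 - 3 * (z * y) * y ^ 2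

/-- The coefficient `d` of `d²v/dx² = 2 d q / y ^ 12`. -/
noncomputable def coeffD (z y : ℝ) : ℝ :=
  -54 + 216 * (z * y) - 70 * y ^ 2 - 266 * (z * y) ^ 2 + 156 * (z * y) * y ^ 2 + 96 * (z * y) ^ 3
    - 20 * y ^ 4 - 70 * (z * y) ^ 2 * y ^ 2 + 12 * (z * y) * y ^ 4

/-- The coefficient `e` of `d³v/dx³ = 2 e q / y ^ 15`. -/
noncomputable def coeffE (z y : ℝ) : ℝ :=
  648 - 3564 * (z * y) + 1240 * y ^ 2 + 6980 * (z * y) ^ 2 - 4608 * (z * y) * y ^ 2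
    - 5652 * (z * y) ^ 3 + 720 * y ^ 4 + 5184 * (z * y) ^ 2 * y ^ 2 + 1536 * (z * y) ^ 4
    - 1456 * (z * y) * y ^ 4 - 1652 * (z * y) ^ 3 * y ^ 2 + 120 * y ^ 6
    + 564 * (z * y) ^ 2 * y ^ 4 - 60 * (z * y) * y ^ 6

/-- Up to a positive rescaling, the discriminant of the binary cubic form with coefficients
proportional to `b`, `c`, `d`, `e`. -/
def cubicDisc (b c d e : ℝ) : ℝ :=
  27 * c ^ 2 * d ^ 2 + 18 * b * c * d * e - b ^ 2 * e ^ 2 - 24 * c ^ 3 * e - 18 * b * d ^ 3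

/-! Positivity of the coefficients of the discriminant as a polynomial in `W = y ^ 2 - x ^ 2`, where
`x = 2 z y`. Each is a sum of squares plus a remainder whose small odd-degree coefficients are
dominated by the neighbouring even ones. -/

theorem discPoly_coeff_zero_pos {x : ℝ} (hx : 0 ≤ x) :
    0 < 1215 - 7290 * x + 46611/2 * x ^ 2 - 105093/2 * x ^ 3 + 1468071/16 * x ^ 4 -
      517401/4 * x ^ 5 + 2384847/16 * x ^ 6 - 140094 * x ^ 7 + 425133/4 * x ^ 8 - 254925/4 * x ^ 9
      + 468495/16 * x ^ 10 - 9720 * x ^ 11 + 34587/16 * x ^ 12 - 288 * x ^ 13 + 18 * x ^ 14 := by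
  have hsq : 0 ≤
        1214.974 * (1 - 3.000063 * x + 1.40108 * x ^ 2 + 2.970369 * x ^ 3 - 3.20273 * x ^ 4 +
          0.90611 * x ^ 5 - 0.026157 * x ^ 6 - 0.010412 * x ^ 7) ^ 2
      + 8965.229 * (x - 2.763481 * x ^ 2 + 2.1207 * x ^ 3 + 0.064837 * x ^ 4 - 0.562949 * x ^ 5 +
          0.16303 * x ^ 6 - 0.011298 * x ^ 7) ^ 2
      + 12312.94 * (x ^ 2 - 2.48087 * x ^ 3 + 1.910894 * x ^ 4 - 0.444075 * x ^ 5 -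
          0.017264 * x ^ 6 + 0.009527 * x ^ 7) ^ 2
      + 6049.54 * (x ^ 3 - 2.134984 * x ^ 4 + 1.366098 * x ^ 5 - 0.3025 * x ^ 6 +
          0.017516 * x ^ 7) ^ 2
      + 1171.58 * (x ^ 4 - 1.708831 * x ^ 5 + 0.719856 * x ^ 6 - 0.080479 * x ^ 7) ^ 2
      + 96.047 * (x ^ 5 - 1.03374 * x ^ 6 + 0.20469 * x ^ 7) ^ 2
      + 17.548 * (x ^ 6 - 0.315844 * x ^ 7) ^ 2
      + 0.386991 * (x ^ 7) ^ 2 := by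
    positivity
  linarith [pow_nonneg hx 1, pow_nonneg hx 2, pow_nonneg hx 3, pow_nonneg hx 4, pow_nonneg hx 5,
    pow_nonneg hx 6, pow_nonneg hx 7, pow_nonneg hx 8, pow_nonneg hx 9, pow_nonneg hx 10,
    pow_nonneg hx 11, pow_nonneg hx 12, pow_nonneg hx 13, pow_nonneg hx 14, sq_nonneg (x - 1),
    sq_nonneg (x ^ 1 * (x - 1)), sq_nonneg (x ^ 2 * (x - 1)), sq_nonneg (x ^ 3 * (x - 1)),
    sq_nonneg (x ^ 4 * (x - 1)), sq_nonneg (x ^ 5 * (x - 1)), sq_nonneg (x ^ 6 * (x - 1))]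

theorem discPoly_coeff_one_pos {x : ℝ} (hx : 0 ≤ x) :
    0 < 1296 - 7776 * x + 28464 * x ^ 2 - 78144 * x ^ 3 + 168087 * x ^ 4 - 289551 * x ^ 5 +
      400917 * x ^ 6 - 443919 * x ^ 7 + 3119469/8 * x ^ 8 - 531915/2 * x ^ 9 + 1095099/8 * x ^ 10
      - 99525/2 * x ^ 11 + 47355/4 * x ^ 12 - 1656 * x ^ 13 + 108 * x ^ 14 := by
  have hsq : 0 ≤
        1295.73 * (1 - 3.00063 * x + 0.06901 * x ^ 2 + 6.21835 * x ^ 3 - 5.40921 * x ^ 4 +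
          1.16118 * x ^ 5 + 0.099 * x ^ 6 - 0.03148 * x ^ 7) ^ 2
      + 16612.74 * (x - 2.82079 * x ^ 2 + 1.82493 * x ^ 3 + 0.79478 * x ^ 4 - 1.00826 * x ^ 5 +
          0.25234 * x ^ 6 - 0.01538 * x ^ 7) ^ 2
      + 37598.25 * (x ^ 2 - 2.54141 * x ^ 3 + 1.8814 * x ^ 4 - 0.32145 * x ^ 5 - 0.07059 * x ^ 6 +
          0.01513 * x ^ 7) ^ 2
      + 28818.12 * (x ^ 3 - 2.14207 * x ^ 4 + 1.34052 * x ^ 5 - 0.28375 * x ^ 6 + 0.01455 * x ^ 7)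
          ^ 2
      + 9064.22 * (x ^ 4 - 1.5821 * x ^ 5 + 0.63093 * x ^ 6 - 0.06658 * x ^ 7) ^ 2
      + 1598.43 * (x ^ 5 - 0.77196 * x ^ 6 + 0.12894 * x ^ 7) ^ 2
      + 197.25 * (x ^ 6 - 0.30694 * x ^ 7) ^ 2
      + 2.72138 * (x ^ 7) ^ 2 := by
    positivity
  linarith [pow_nonneg hx 1, pow_nonneg hx 2, pow_nonneg hx 3, pow_nonneg hx 4, pow_nonneg hx 5,
    pow_nonneg hx 6, pow_nonneg hx 7, pow_nonneg hx 8, pow_nonneg hx 9, pow_nonneg hx 10,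
    pow_nonneg hx 11, pow_nonneg hx 12, pow_nonneg hx 13, pow_nonneg hx 14, sq_nonneg (x - 1),
    sq_nonneg (x ^ 1 * (x - 1)), sq_nonneg (x ^ 2 * (x - 1)), sq_nonneg (x ^ 3 * (x - 1)),
    sq_nonneg (x ^ 4 * (x - 1)), sq_nonneg (x ^ 5 * (x - 1)), sq_nonneg (x ^ 6 * (x - 1))]

theorem discPoly_coeff_two_pos {x : ℝ} (hx : 0 ≤ x) :
    0 < 3776 - 23360 * x + 81854 * x ^ 2 - 200720 * x ^ 3 + 367790 * x ^ 4 - 511013 * x ^ 5 +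
      4358179/8 * x ^ 6 - 1748429/4 * x ^ 7 + 4144871/16 * x ^ 8 - 209679/2 * x ^ 9 +
      215121/8 * x ^ 10 - 3960 * x ^ 11 + 270 * x ^ 12 := by
  have hsq : 0 ≤
        3773.36 * (1 - 3.09539 * x + 1.40243 * x ^ 2 + 2.47309 * x ^ 3 - 2.13102 * x ^ 4 +
          0.48967 * x ^ 5 - 0.02693 * x ^ 6) ^ 2
      + 35058.84 * (x - 2.66157 * x ^ 2 + 1.84734 * x ^ 3 - 0.11628 * x ^ 4 - 0.16017 * x ^ 5 +
          0.02437 * x ^ 6) ^ 2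
      + 56078.44 * (x ^ 2 - 2.11983 * x ^ 3 + 1.26366 * x ^ 4 - 0.24745 * x ^ 5 + 0.01023 * x ^ 6)
          ^ 2
      + 31667.75 * (x ^ 3 - 1.44455 * x ^ 4 + 0.53914 * x ^ 5 - 0.05296 * x ^ 6) ^ 2
      + 7947.18 * (x ^ 4 - 0.67573 * x ^ 5 + 0.10175 * x ^ 6) ^ 2
      + 652.72 * (x ^ 5 - 0.30767 * x ^ 6) ^ 2
      + 7.49821 * (x ^ 6) ^ 2 := by
    positivity
  linarith [pow_nonneg hx 1, pow_nonneg hx 2, pow_nonneg hx 3, pow_nonneg hx 4, pow_nonneg hx 5,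
    pow_nonneg hx 6, pow_nonneg hx 7, pow_nonneg hx 8, pow_nonneg hx 9, pow_nonneg hx 10,
    pow_nonneg hx 11, pow_nonneg hx 12, sq_nonneg (x - 1), sq_nonneg (x ^ 1 * (x - 1)), sq_nonneg
    (x ^ 2 * (x - 1)), sq_nonneg (x ^ 3 * (x - 1)), sq_nonneg (x ^ 4 * (x - 1)), sq_nonneg (x ^ 5
    * (x - 1))]

theorem discPoly_coeff_three_pos {x : ℝ} (hx : 0 ≤ x) :
    0 < 7632 - 41648 * x + 127280 * x ^ 2 - 250520 * x ^ 3 + 353485 * x ^ 4 - 352327 * x ^ 5 +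
      502949/2 * x ^ 6 - 232047/2 * x ^ 7 + 129627/4 * x ^ 8 - 5040 * x ^ 9 + 360 * x ^ 10 := by
  have hsq : 0 ≤
        7621.3 * (1 - 2.7323 * x + 1.3747 * x ^ 2 + 0.5748 * x ^ 3 - 0.4005 * x ^ 4 +
          0.0454 * x ^ 5) ^ 2
      + 49250.3 * (x - 2.0511 * x ^ 2 + 1.0851 * x ^ 3 - 0.1679 * x ^ 4 + 0.0016 * x ^ 5) ^ 2
      + 54560.4 * (x ^ 2 - 1.3378 * x ^ 3 + 0.4663 * x ^ 4 - 0.042 * x ^ 5) ^ 2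
      + 18296.3 * (x ^ 3 - 0.6163 * x ^ 4 + 0.0845 * x ^ 5) ^ 2
      + 1150.6 * (x ^ 4 - 0.3019 * x ^ 5) ^ 2
      + 12 * (x ^ 5) ^ 2 := by
    positivity
  linarith [pow_nonneg hx 1, pow_nonneg hx 2, pow_nonneg hx 3, pow_nonneg hx 4, pow_nonneg hx 5,
    pow_nonneg hx 6, pow_nonneg hx 7, pow_nonneg hx 8, pow_nonneg hx 9, pow_nonneg hx 10,
    sq_nonneg (x - 1), sq_nonneg (x ^ 1 * (x - 1)), sq_nonneg (x ^ 2 * (x - 1)), sq_nonneg (x ^ 3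
    * (x - 1)), sq_nonneg (x ^ 4 * (x - 1))]

theorem discPoly_coeff_four_pos {x : ℝ} (hx : 0 ≤ x) :
    0 < 11040 - 43296 * x + 101003 * x ^ 2 - 138518 * x ^ 3 + 259621/2 * x ^ 4 - 141717/2 * x ^ 5
      + 349467/16 * x ^ 6 - 3600 * x ^ 7 + 270 * x ^ 8 := by
  have hsq : 0 ≤
        11009.09 * (1 - 1.96638 * x + 0.78508 * x ^ 2 - 0.0307 * x ^ 3 - 0.01298 * x ^ 4) ^ 2
      + 40866 * (x - 1.27063 * x ^ 2 + 0.42086 * x ^ 3 - 0.03524 * x ^ 4) ^ 2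
      + 21242.51 * (x ^ 2 - 0.57204 * x ^ 3 + 0.07213 * x ^ 4) ^ 2
      + 1081.12 * (x ^ 3 - 0.2977 * x ^ 4) ^ 2
      + 10.32 * (x ^ 4) ^ 2 := by
    positivity
  linarith [pow_nonneg hx 1, pow_nonneg hx 2, pow_nonneg hx 3, pow_nonneg hx 4, pow_nonneg hx 5,
    pow_nonneg hx 6, pow_nonneg hx 7, pow_nonneg hx 8, sq_nonneg (x - 1), sq_nonneg (x ^ 1 * (x -
    1)), sq_nonneg (x ^ 2 * (x - 1)), sq_nonneg (x ^ 3 * (x - 1))]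

theorem discPoly_coeff_five_pos {x : ℝ} (hx : 0 ≤ x) :
    0 < 8640 - 21072 * x + 32664 * x ^ 2 - 22512 * x ^ 3 + 7800 * x ^ 4 - 1368 * x ^ 5 +
      108 * x ^ 6 := by
  have hsq : 0 ≤
        8591.6 * (1 - 1.2263 * x + 0.3917 * x ^ 2 - 0.0311 * x ^ 3) ^ 2
      + 12830.1 * (x - 0.5348 * x ^ 2 + 0.0622 * x ^ 3) ^ 2
      + 517.2 * (x ^ 2 - 0.2951 * x ^ 3) ^ 2
      + 4.427 * (x ^ 3) ^ 2 := by
    positivity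
  linarith [pow_nonneg hx 1, pow_nonneg hx 2, pow_nonneg hx 3, pow_nonneg hx 4, pow_nonneg hx 5,
    pow_nonneg hx 6, sq_nonneg (x - 1), sq_nonneg (x ^ 1 * (x - 1)), sq_nonneg (x ^ 2 * (x - 1))]

theorem discPoly_coeff_six_pos {x : ℝ} (hx : 0 ≤ x) :
    0 < 2880 - 2880 * x + 1152 * x ^ 2 - 216 * x ^ 3 + 18 * x ^ 4 := by
  have hsq : 0 ≤
        2850 * (1 - 0.505 * x + 0.055 * x ^ 2) ^ 2
      + 101 * (x - 0.291 * x ^ 2) ^ 2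
      + 0.779 * (x ^ 2) ^ 2 := by
    positivity
  linarith [pow_nonneg hx 1, pow_nonneg hx 2, pow_nonneg hx 3, pow_nonneg hx 4, sq_nonneg (x - 1),
    sq_nonneg (x ^ 1 * (x - 1))]

/-- The discriminant of the coefficients is positive for `0 ≤ z ≤ 1 / 2`. In terms of `x = 2 z y`
and `W = y ^ 2 - x ^ 2 ≥ 0` it is a polynomial in `W` whose coefficients are positive for `x ≥ 0`
(up to the factor `x ^ 2` in the constant one). -/
theorem cubicDisc_coeff_pos {z y : ℝ} (hz0 : 0 ≤ z) (hz : z ≤ 1 / 2) (hy : 0 < y) :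
    0 < cubicDisc (coeffB z y) (coeffC z y) (coeffD z y) (coeffE z y) := by
  obtain ⟨x, hx⟩ : ∃ x, x = 2 * (z * y) := ⟨_, rfl⟩
  obtain ⟨W, hW⟩ : ∃ W, W = y ^ 2 - x ^ 2 := ⟨_, rfl⟩
  have hx0 : 0 ≤ x := by rw [hx]; positivity
  have hW0 : 0 ≤ W := by
    have : x ≤ y := by rw [hx]; nlinarith
    rw [hW]; nlinarith
  have hzy : z * y = x / 2 := by linarith
  have hy2 : y ^ 2 = x ^ 2 + W := by linarith
  have hy4 : y ^ 4 = (x ^ 2 + W) ^ 2 := by rw [← hy2]; ring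
  have hy6 : y ^ 6 = (x ^ 2 + W) ^ 3 := by rw [← hy2]; ring
  have p0 := discPoly_coeff_zero_pos hx0
  have p1 := discPoly_coeff_one_pos hx0
  have p2 := mul_nonneg (discPoly_coeff_two_pos hx0).le (pow_nonneg hW0 2)
  have p3 := mul_nonneg (discPoly_coeff_three_pos hx0).le (pow_nonneg hW0 3)
  have p4 := mul_nonneg (discPoly_coeff_four_pos hx0).le (pow_nonneg hW0 4)
  have p5 := mul_nonneg (discPoly_coeff_five_pos hx0).le (pow_nonneg hW0 5)
  have p6 := mul_nonneg (discPoly_coeff_six_pos hx0).le (pow_nonneg hW0 6)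
  have key : ∀ P0 P1 : ℝ, 0 < P0 → 0 < P1 → 0 < P0 * x ^ 2 + P1 * W := by
    intro P0 P1 h0 h1
    rcases hx0.eq_or_lt with h | h
    · have : 0 < W := by rw [hW, ← h]; simpa using pow_pos hy 2
      positivity
    · positivity
  have p01 := key _ _ p0 p1
  simp only [cubicDisc, coeffB, coeffC, coeffD, coeffE, hzy, hy2, hy4, hy6]
  linear_combination p01 + p2 + p3 + p4 + p5 + p6

/-- If a quadratic `Q = d u² + 4 c u + 2 b` vanishes at `u > 0` and the discriminant is positive,
then `R = e u² + 6 d u + 6 c` and `M = d u + 2 c` have the same strict sign: eliminating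
`b`, `d`, `e` in favour of `M` and `R` turns the discriminant, up to a positive factor, into
`12 M³ R - (R (M + 2 c))²`. -/
theorem mul_pos_of_cubicDisc_pos {b c d e u : ℝ} (hu : 0 < u) (hN : 0 < cubicDisc b c d e)
    (hQ : d * u ^ 2 + 4 * c * u + 2 * b = 0) :
    0 < (e * u ^ 2 + 6 * d * u + 6 * c) * (d * u + 2 * c) := by
  obtain ⟨M, hM⟩ : ∃ M, M = d * u + 2 * c := ⟨_, rfl⟩
  obtain ⟨R, hR⟩ : ∃ R, R = e * u ^ 2 + 6 * d * u + 6 * c := ⟨_, rfl⟩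
  have hb : b = -(u * (M + 2 * c)) / 2 := by rw [hM]; linear_combination hQ / 2
  have hd : d = (M - 2 * c) / u := by rw [hM]; field_simp; ring
  have he : e = (R - 6 * M + 6 * c) / u ^ 2 := by rw [hM, hR]; field_simp; ring
  have key : cubicDisc b c d e * (4 * u ^ 2) = 12 * M ^ 3 * R - (R * (M + 2 * c)) ^ 2 := by
    rw [cubicDisc, hb, hd, he]; field_simp; ring
  rw [← hR, ← hM]
  have h1 : 0 < 12 * M ^ 3 * R - (R * (M + 2 * c)) ^ 2 := by rw [← key]; positivity
  by_contra! h
  nlinarith [mul_nonneg (sq_nonneg M) (neg_nonneg.2 h), sq_nonneg (R * (M + 2 * c))]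

/-- Positivity of the discriminant forces the quadratic `d u² + 4 c u + 2 b` to have two distinct
real roots. -/
theorem quadratic_disc_pos_of_cubicDisc_pos {b c d e : ℝ} (hN : 0 < cubicDisc b c d e) :
    0 < 2 * c ^ 2 - b * d := by
  rcases eq_or_ne b 0 with rfl | hb
  · have hc : c ≠ 0 := by
      rintro rfl
      simp [cubicDisc] at hN
    rw [zero_mul, sub_zero]; positivity
  · have h : 18 * (2 * c ^ 2 - b * d) ^ 3
        = b ^ 2 * cubicDisc b c d e + (12 * c ^ 3 - 9 * b * c * d + b ^ 2 * e) ^ 2 := by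
      rw [cubicDisc]; ring
    have h3 : 0 < (2 * c ^ 2 - b * d) ^ 3 := by
      have : 0 < b ^ 2 * cubicDisc b c d e := by positivity
      nlinarith [sq_nonneg (12 * c ^ 3 - 9 * b * c * d + b ^ 2 * e)]
    exact (Odd.pow_pos_iff (by decide)).1 h3

/-! ### A barrier for the tortoise coordinate -/

/-- The polynomial `g` for which `y ^ 3 / g` is a lower barrier for `φ_z⁻¹(y)`. Its coefficients
up to order `y ^ 2` are those of the expansion of `y ^ 3 / φ_z⁻¹(y)` at `0`; the cubic coefficient
is rounded up to a value that works for all `0 ≤ z ≤ 1 / 2`. -/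
noncomputable def barrier (z y : ℝ) : ℝ :=
  3 - 9 / 2 * (z * y) + 9 / 5 * y ^ 2 - 9 / 20 * (z * y) ^ 2 + 3 / 5 * (z * y) * y ^ 2

theorem barrier_pos {z y : ℝ} (hz0 : 0 ≤ z) (hz : z ≤ 1 / 2) (hy : 0 ≤ y) : 0 < barrier z y := by
  have h1 : z * y ≤ y / 2 := by nlinarith
  have h2 : 0 ≤ z * y := by positivity
  have h3 : 0 ≤ z * y * y ^ 2 := by positivity
  have h4 : 4 * (z * y) ^ 2 ≤ y ^ 2 := by nlinarith
  rw [barrier]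
  nlinarith [sq_nonneg (z * y - 1 / 3)]

/-- The coefficient `d + 2 c g` is negative; hence the vertex of `d u² + 4 c u + 2 b` lies
below `1 / g` where `d < 0`. -/
theorem coeffD_add_barrier_neg {z y : ℝ} (hz0 : 0 ≤ z) (hz : z ≤ 1 / 2) (hy : 0 ≤ y) :
    coeffD z y + 2 * coeffC z y * barrier z y < 0 := by
  obtain ⟨x, hx⟩ : ∃ x, x = 2 * (z * y) := ⟨_, rfl⟩
  obtain ⟨W, hW⟩ : ∃ W, W = y ^ 2 - x ^ 2 := ⟨_, rfl⟩
  have hx0 : 0 ≤ x := by rw [hx]; positivity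
  have hW0 : 0 ≤ W := by
    have : x ≤ y := by rw [hx]; nlinarith
    rw [hW]; nlinarith
  have hzy : z * y = x / 2 := by linarith
  have hy2 : y ^ 2 = x ^ 2 + W := by linarith
  have hy4 : y ^ 4 = (x ^ 2 + W) ^ 2 := by rw [← hy2]; ring
  have p0 : 0 < 18 - 36 * x + 93 / 2 * x ^ 2 - 2583 / 80 * x ^ 3 + 15 * x ^ 4 - 363 / 80 * x ^ 5
      + 9 / 10 * x ^ 6 := by
    nlinarith [sq_nonneg (1 - x), sq_nonneg (x * (1 - x)), sq_nonneg (x ^ 2 * (x - 2)),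
      sq_nonneg (x * (x - 1) * (x - 2))]
  have p1 : 0 ≤ 122 / 5 - 138 / 5 * x + 403 / 20 * x ^ 2 - 603 / 80 * x ^ 3 + 9 / 5 * x ^ 4 := by
    nlinarith [sq_nonneg (1 - x), sq_nonneg (x * (2 - x))]
  have p2 : 0 ≤ 28 / 5 - 3 * x + 9 / 10 * x ^ 2 := by nlinarith [sq_nonneg (x - 5 / 3)]
  simp only [barrier, coeffC, coeffD, hzy, hy2, hy4]
  linear_combination p0 + mul_nonneg p1 hW0 + mul_nonneg p2 (sq_nonneg W)

/-- The derivative of `y ^ 3 / g` is at most `y ^ 2 / q`, the derivative of `φ_z⁻¹`, after clearing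
denominators; the first factor on the left is `3 g - y g'`. -/
theorem three_mul_barrier_sub_mul_quad_le {z y : ℝ} (hz0 : 0 ≤ z) (hz : z ≤ 1 / 2) (hy : 0 ≤ y) :
    (9 - 9 * (z * y) + 9 / 5 * y ^ 2 - 9 / 20 * (z * y) ^ 2) * (y ^ 2 - 2 * z * y + 1)
      ≤ barrier z y ^ 2 := by
  obtain ⟨x, hx⟩ : ∃ x, x = 2 * (z * y) := ⟨_, rfl⟩
  obtain ⟨W, hW⟩ : ∃ W, W = y ^ 2 - x ^ 2 := ⟨_, rfl⟩
  have hx0 : 0 ≤ x := by rw [hx]; positivity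
  have hW0 : 0 ≤ W := by
    have : x ≤ y := by rw [hx]; nlinarith
    rw [hW]; nlinarith
  have hzy : z * y = x / 2 := by linarith
  have hzy2 : 2 * z * y = x := by linarith
  have hy2 : y ^ 2 = x ^ 2 + W := by linarith
  have p0 : 0 ≤ x ^ 3 * (63 / 160 - 243 / 1280 * x + 81 / 80 * x ^ 2 + 9 / 100 * x ^ 3) := by
    have : 0 ≤ 63 / 160 - 243 / 1280 * x + 81 / 80 * x ^ 2 := by nlinarith [sq_nonneg (x - 1 / 10)]
    positivity
  have p1 : 0 ≤ W * (99 / 80 * x ^ 2 + 837 / 400 * x ^ 3 + 9 / 50 * x ^ 4)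
      + W ^ 2 * (36 / 25 + 27 / 25 * x + 9 / 100 * x ^ 2) := by positivity
  simp only [barrier, hzy, hzy2, hy2]
  linear_combination p0 + p1

theorem hasDerivAt_barrier (z y : ℝ) :
    HasDerivAt (barrier z)
      (-(9 / 2 * z) + 2 * (9 / 5 - 9 / 20 * z ^ 2) * y + 9 / 5 * z * y ^ 2) y := by
  have h := ((((hasDerivAt_id y).const_mul (9 / 2 * z)).const_sub 3).add
    ((hasDerivAt_pow 2 y).const_mul (9 / 5 - 9 / 20 * z ^ 2))).add
    ((hasDerivAt_pow 3 y).const_mul (3 / 5 * z))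
  refine (h.congr_of_eventuallyEq (.of_forall fun s => ?_)).congr_deriv ?_
  · simp [barrier]; ring
  · simp; ring

theorem abs_lt_abs_one {z : ℝ} (hz0 : 0 ≤ z) (hz : z ≤ 1 / 2) : |z| < |(1 : ℝ)| := by
  rw [abs_of_nonneg hz0, abs_one]; linarith

theorem tortoise_lower_barrier {z y : ℝ} (hz0 : 0 ≤ z) (hz : z ≤ 1 / 2) (hy : 0 < y) :
    y ^ 3 / barrier z y ≤ tortoise z 1 y := by
  have h := abs_lt_abs_one hz0 hz
  have hder : ∀ s, 0 ≤ s → HasDerivAt (fun s => tortoise z 1 s - s ^ 3 / barrier z s)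
      (s ^ 2 / (s ^ 2 - 2 * z * s + 1) -
        s ^ 2 * (9 - 9 * (z * s) + 9 / 5 * s ^ 2 - 9 / 20 * (z * s) ^ 2) / barrier z s ^ 2) s := by
    intro s hs
    have hb := (barrier_pos hz0 hz hs).ne'
    refine ((hasDerivAt_tortoise h s).sub ((hasDerivAt_pow 3 s).div
      (hasDerivAt_barrier z s) hb)).congr_deriv ?_
    rw [one_pow]
    congr 2
    rw [barrier]; push_cast; ring
  have hmono : MonotoneOn (fun s => tortoise z 1 s - s ^ 3 / barrier z s) (Ici 0) := by
    refine monotoneOn_of_deriv_nonneg (convex_Ici _)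
      (fun s hs => (hder s hs).continuousAt.continuousWithinAt) ?_ ?_
    · intro s hs
      rw [interior_Ici] at hs
      exact (hder s (le_of_lt hs)).differentiableAt.differentiableWithinAt
    · intro s hs
      rw [interior_Ici] at hs
      rw [(hder s (le_of_lt hs)).deriv, sub_nonneg]
      have hb := barrier_pos hz0 hz (le_of_lt hs)
      have hq := quad_pos h s
      rw [one_pow] at hq
      rw [div_le_div_iff₀ (by positivity) hq, mul_assoc]
      exact mul_le_mul_of_nonneg_left (three_mul_barrier_sub_mul_quad_le hz0 hz (le_of_lt hs)) (sq_nonneg s)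
  have := hmono (mem_Ici.2 le_rfl) (mem_Ici.2 hy.le) hy.le
  simp [tortoise_zero] at this
  exact this

/-! ### The profile `j_z` and its derivative -/

/-- The ratio `u = φ_z⁻¹(y) / y ^ 3`, which extends continuously by `1 / 3` to `y = 0`. -/
noncomputable def ratio (z y : ℝ) : ℝ := tortoise z 1 y / y ^ 3

/-- The quadratic `Q = d u² + 4 c u + 2 b` in `u = φ_z⁻¹(y) / y ^ 3`; with `x = φ_z⁻¹(y)` one has
`(x² v)'' = 2 q Q / y ^ 6`, and `Q` has the sign of `j_z'`. -/
noncomputable def critQ (z y : ℝ) : ℝ :=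
  coeffD z y * ratio z y ^ 2 + 4 * coeffC z y * ratio z y + 2 * coeffB z y

/-- The quadratic `R = e u² + 6 d u + 6 c`, for which `(x² v)''' = 2 q R / y ^ 9`. -/
noncomputable def critR (z y : ℝ) : ℝ :=
  coeffE z y * ratio z y ^ 2 + 6 * coeffD z y * ratio z y + 6 * coeffC z y

/-- Half the derivative of `Q` with respect to `u`. Its sign tells which root of the quadratic
`u` is at. -/
noncomputable def critM (z y : ℝ) : ℝ := coeffD z y * ratio z y + 2 * coeffC z y

/-- Half of `(x² v)''` as a function of `y`. -/
noncomputable def halfH (z y : ℝ) : ℝ := (y ^ 2 - 2 * z * y + 1) * critQ z y / y ^ 6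

theorem hasDerivAt_quintic (a₀ a₁ a₂ a₃ a₄ a₅ y : ℝ) :
    HasDerivAt (fun y => a₀ + a₁ * y + a₂ * y ^ 2 + a₃ * y ^ 3 + a₄ * y ^ 4 + a₅ * y ^ 5)
      (a₁ + 2 * a₂ * y + 3 * a₃ * y ^ 2 + 4 * a₄ * y ^ 3 + 5 * a₅ * y ^ 4) y := by
  have h := ((((((hasDerivAt_id y).const_mul a₁).const_add a₀).add
    ((hasDerivAt_pow 2 y).const_mul a₂)).add ((hasDerivAt_pow 3 y).const_mul a₃)).add
    ((hasDerivAt_pow 4 y).const_mul a₄)).add ((hasDerivAt_pow 5 y).const_mul a₅)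
  exact h.congr_deriv (by simp; ring)

theorem hasDerivAt_quad (z y : ℝ) :
    HasDerivAt (fun y => y ^ 2 - 2 * z * y + 1) (2 * y - 2 * z) y :=
  ((hasDerivAt_quintic 1 (-(2 * z)) 1 0 0 0 y).congr_of_eventuallyEq
    (.of_forall fun s => by ring)).congr_deriv (by ring)

theorem hasDerivAt_coeffB (z y : ℝ) : HasDerivAt (coeffB z) z y :=
  ((hasDerivAt_quintic (-1) z 0 0 0 0 y).congr_of_eventuallyEq
    (.of_forall fun s => by simp only [coeffB]; ring)).congr_deriv (by ring)

theorem hasDerivAt_coeffC (z y : ℝ) :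
    HasDerivAt (coeffC z) (-(15 * z) + 2 * (8 * z ^ 2 + 4) * y - 9 * z * y ^ 2) y :=
  ((hasDerivAt_quintic 6 (-(15 * z)) (8 * z ^ 2 + 4) (-(3 * z)) 0 0 y).congr_of_eventuallyEq
    (.of_forall fun s => by simp only [coeffC]; ring)).congr_deriv (by ring)

theorem hasDerivAt_coeffD (z y : ℝ) :
    HasDerivAt (coeffD z) (216 * z + 2 * (-70 - 266 * z ^ 2) * y
      + 3 * (156 * z + 96 * z ^ 3) * y ^ 2 + 4 * (-20 - 70 * z ^ 2) * y ^ 3 + 60 * z * y ^ 4) y :=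
  ((hasDerivAt_quintic (-54) (216 * z) (-70 - 266 * z ^ 2) (156 * z + 96 * z ^ 3)
    (-20 - 70 * z ^ 2) (12 * z) y).congr_of_eventuallyEq
    (.of_forall fun s => by simp only [coeffD]; ring)).congr_deriv (by ring)

theorem continuous_coeffB (z : ℝ) : Continuous (coeffB z) := by unfold coeffB; fun_prop

theorem continuous_coeffC (z : ℝ) : Continuous (coeffC z) := by unfold coeffC; fun_prop

theorem continuous_coeffD (z : ℝ) : Continuous (coeffD z) := by unfold coeffD; fun_prop

theorem quad_one_pos {z : ℝ} (h : |z| < |(1 : ℝ)|) (y : ℝ) : 0 < y ^ 2 - 2 * z * y + 1 := by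
  simpa using quad_pos h y

theorem hasDerivAt_ratio {z y : ℝ} (h : |z| < |(1 : ℝ)|) (hy : 0 < y) :
    HasDerivAt (ratio z) ((1 / (y ^ 2 - 2 * z * y + 1) - 3 * ratio z y) / y) y := by
  have hq := (quad_one_pos h y).ne'
  refine ((hasDerivAt_tortoise h y).div (hasDerivAt_pow 3 y) (by positivity)).congr_deriv ?_
  rw [one_pow, ratio]
  field_simp
  push_cast
  ring

theorem ratio_pos {z y : ℝ} (h : |z| < |(1 : ℝ)|) (hy : 0 < y) : 0 < ratio z y :=
  div_pos ((tortoise_bijOn h).mapsTo hy) (by positivity)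

theorem j_eq_ratio {z y : ℝ} (hy : y ≠ 0) :
    j z y = 2 * (y ^ 2 - 2 * z * y + 1) * ratio z y ^ 2
      * (coeffC z y * ratio z y + coeffB z y) := by
  rw [j, if_neg hy, w, ratio, coeffC, coeffB]
  field_simp
  ring

theorem hasDerivAt_j {z y : ℝ} (h : |z| < |(1 : ℝ)|) (hy : 0 < y) :
    HasDerivAt (j z) (2 * ratio z y * critQ z y / y) y := by
  have hq := (quad_one_pos h y).ne'
  have hu := hasDerivAt_ratio h hy
  have H := (((hasDerivAt_quad z y).const_mul 2).mul (hu.pow 2)).mul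
    (((hasDerivAt_coeffC z y).mul hu).add (hasDerivAt_coeffB z y))
  refine (H.congr_of_eventuallyEq ?_).congr_deriv ?_
  · filter_upwards [lt_mem_nhds hy] with s hs
    exact j_eq_ratio hs.ne'
  · simp only [critQ, Pi.mul_apply, Pi.pow_apply, Pi.add_apply]
    obtain ⟨k, hk⟩ : ∃ k, k = 1 / (y ^ 2 - 2 * z * y + 1) := ⟨_, rfl⟩
    have hkq : k * (y ^ 2 - 2 * z * y + 1) = 1 := by rw [hk]; exact one_div_mul_cancel hq
    obtain ⟨δ, hδ⟩ : ∃ δ, δ = (k - 3 * ratio z y) / y := ⟨_, rfl⟩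
    have hδy : δ * y = k - 3 * ratio z y := by rw [hδ, div_mul_cancel₀ _ hy.ne']
    rw [← hk, ← hδ, eq_div_iff hy.ne']
    generalize ratio z y = u at *
    push_cast
    linear_combination (norm := (simp only [coeffB, coeffC, coeffD]; ring))
      (2 * (y ^ 2 - 2 * z * y + 1) * (3 * coeffC z y * u ^ 2
      + 2 * coeffB z y * u)) * hδy + (2 * (3 * coeffC z y * u ^ 2 + 2 * coeffB z y * u)) * hkq

theorem hasDerivAt_halfH {z y : ℝ} (h : |z| < |(1 : ℝ)|) (hy : 0 < y) :
    HasDerivAt (halfH z) (critR z y / y ^ 7) y := by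
  have hq := (quad_one_pos h y).ne'
  have hu := hasDerivAt_ratio h hy
  have H := ((hasDerivAt_quad z y).mul ((((hasDerivAt_coeffD z y).mul (hu.pow 2)).add
    (((hasDerivAt_coeffC z y).const_mul 4).mul hu)).add
    ((hasDerivAt_coeffB z y).const_mul 2))).div (hasDerivAt_pow 6 y) (by positivity)
  refine (H.congr_of_eventuallyEq ?_).congr_deriv ?_
  · exact .of_forall fun s => rfl
  · simp only [critR, Pi.mul_apply, Pi.pow_apply, Pi.add_apply]
    obtain ⟨k, hk⟩ : ∃ k, k = 1 / (y ^ 2 - 2 * z * y + 1) := ⟨_, rfl⟩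
    have hkq : k * (y ^ 2 - 2 * z * y + 1) = 1 := by rw [hk]; exact one_div_mul_cancel hq
    obtain ⟨δ, hδ⟩ : ∃ δ, δ = (k - 3 * ratio z y) / y := ⟨_, rfl⟩
    have hδy : δ * y = k - 3 * ratio z y := by rw [hδ, div_mul_cancel₀ _ hy.ne']
    rw [← hk, ← hδ, div_eq_div_iff (by positivity) (by positivity)]
    generalize ratio z y = u at *
    push_cast
    linear_combination (norm := (simp only [coeffB, coeffC, coeffD, coeffE]; ring))
      (y ^ 12 * (y ^ 2 - 2 * z * y + 1) * (2 * coeffD z y * u + 4 * coeffC z y)) * hδy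
      + (y ^ 12 * (2 * coeffD z y * u + 4 * coeffC z y)) * hkq

theorem critM_continuousOn {z : ℝ} (h : |z| < |(1 : ℝ)|) : ContinuousOn (critM z) (Ioi 0) := by
  intro y hy
  exact (((continuous_coeffD z).continuousAt.mul (hasDerivAt_ratio h hy).continuousAt).add
    (continuous_const.mul (continuous_coeffC z)).continuousAt).continuousWithinAt

theorem halfH_pos_iff {z y : ℝ} (h : |z| < |(1 : ℝ)|) (hy : 0 < y) :
    0 < halfH z y ↔ 0 < critQ z y := by
  have hq := quad_one_pos h y
  rw [halfH, div_pos_iff_of_pos_right (by positivity), mul_pos_iff_of_pos_left hq]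

theorem halfH_eq_zero_iff {z y : ℝ} (h : |z| < |(1 : ℝ)|) (hy : 0 < y) :
    halfH z y = 0 ↔ critQ z y = 0 := by
  have hq := (quad_one_pos h y).ne'
  simp [halfH, hq, hy.ne']

theorem halfH_neg_iff {z y : ℝ} (h : |z| < |(1 : ℝ)|) (hy : 0 < y) :
    halfH z y < 0 ↔ critQ z y < 0 := by
  rw [← not_le, ← not_le, le_iff_lt_or_eq, le_iff_lt_or_eq, halfH_pos_iff h hy, eq_comm,
    halfH_eq_zero_iff h hy, eq_comm]

/-! ### Sign changes of `(x² v)''` -/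

theorem inv_barrier_le_ratio {z y : ℝ} (hz0 : 0 ≤ z) (hz : z ≤ 1 / 2) (hy : 0 < y) :
    1 / barrier z y ≤ ratio z y := by
  rw [ratio, le_div_iff₀ (by positivity), one_div_mul_eq_div]
  exact tortoise_lower_barrier hz0 hz hy

theorem critM_neg_of_coeffD_nonpos {z y : ℝ} (hz0 : 0 ≤ z) (hz : z ≤ 1 / 2) (hy : 0 < y)
    (hd : coeffD z y ≤ 0) : critM z y < 0 := by
  have hg := barrier_pos hz0 hz hy.le
  calc critM z y ≤ coeffD z y * (1 / barrier z y) + 2 * coeffC z y :=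
        add_le_add_left (mul_le_mul_of_nonpos_left (inv_barrier_le_ratio hz0 hz hy) hd) _
    _ = (coeffD z y + 2 * coeffC z y * barrier z y) / barrier z y := by field_simp
    _ < 0 := div_neg_of_neg_of_pos (coeffD_add_barrier_neg hz0 hz hy.le) hg

/-- At a vertex of the quadratic `Q` its value is negative: by the barrier this happens only where
the quadratic is convex, and it always has two distinct real roots. -/
theorem critQ_neg_of_critM_eq_zero {z y : ℝ} (hz0 : 0 ≤ z) (hz : z ≤ 1 / 2) (hy : 0 < y)
    (hM : critM z y = 0) : critQ z y < 0 := by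
  have hd : 0 < coeffD z y := by
    by_contra! hd
    exact (critM_neg_of_coeffD_nonpos hz0 hz hy hd).ne hM
  have hdisc := quadratic_disc_pos_of_cubicDisc_pos (cubicDisc_coeff_pos hz0 hz hy)
  have : coeffD z y * critQ z y
      = critM z y ^ 2 - 2 * (2 * coeffC z y ^ 2 - coeffB z y * coeffD z y) := by
    rw [critQ, critM]; ring
  rw [hM] at this
  by_contra! hQ
  nlinarith [mul_nonneg hd.le hQ]

theorem critR_mul_critM_pos {z y : ℝ} (hz0 : 0 ≤ z) (hz : z ≤ 1 / 2) (hy : 0 < y)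
    (hQ : critQ z y = 0) : 0 < critR z y * critM z y :=
  mul_pos_of_cubicDisc_pos (ratio_pos (abs_lt_abs_one hz0 hz) hy)
    (cubicDisc_coeff_pos hz0 hz hy) hQ

/-- Near `y = 0` the function `j_z` decreases: the barrier agrees with `y ^ 3 / φ_z⁻¹(y)` to second
order, and `g² Q(1 / g) = -(2 / 5 - z² / 10) y² + O(y³)`. -/
theorem eventually_critQ_neg {z : ℝ} (hz0 : 0 ≤ z) (hz : z ≤ 1 / 2) :
    ∀ᶠ y in 𝓝[>] 0, critQ z y < 0 := by
  have hd : ∀ᶠ y in 𝓝[>] (0 : ℝ), coeffD z y < 0 := by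
    refine nhdsWithin_le_nhds ((continuous_coeffD z).continuousAt.tendsto.eventually_lt_const ?_)
    norm_num [coeffD]
  have hr : ∀ᶠ y in 𝓝[>] (0 : ℝ), -(2 / 5) + z ^ 2 / 10 + (6 / 5 * z + 6 * z ^ 3) * y
      + (58 / 25 - 319 / 25 * z ^ 2 - 1341 / 200 * z ^ 4) * y ^ 2
      + (54 / 25 * z + 291 / 25 * z ^ 3 + 81 / 200 * z ^ 5) * y ^ 3
      + (-(18 / 5) * z ^ 2 - 27 / 25 * z ^ 4) * y ^ 4 + 18 / 25 * z ^ 3 * y ^ 5 < 0 := by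
    refine nhdsWithin_le_nhds
      (ContinuousAt.tendsto (by fun_prop) |>.eventually_lt_const (by nlinarith))
  filter_upwards [hd, hr, self_mem_nhdsWithin] with y hd hr hy
  have hy : 0 < y := hy
  have hg := barrier_pos hz0 hz hy.le
  have hu := inv_barrier_le_ratio hz0 hz hy
  have hslope : coeffD z y * (1 / barrier z y) + 2 * coeffC z y < 0 := by
    have := div_neg_of_neg_of_pos (coeffD_add_barrier_neg hz0 hz hy.le) hg
    calc _ = (coeffD z y + 2 * coeffC z y * barrier z y) / barrier z y := by field_simp
      _ < 0 := this
  have hval : coeffD z y * (1 / barrier z y) ^ 2 + 4 * coeffC z y * (1 / barrier z y)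
      + 2 * coeffB z y < 0 := by
    have h1 : coeffD z y + 4 * coeffC z y * barrier z y + 2 * coeffB z y * barrier z y ^ 2 < 0 := by
      refine lt_of_eq_of_lt ?_ (mul_neg_of_pos_of_neg (pow_pos hy 2) hr)
      rw [coeffB, coeffC, coeffD, barrier]; ring
    calc _ = (coeffD z y + 4 * coeffC z y * barrier z y + 2 * coeffB z y * barrier z y ^ 2)
          / barrier z y ^ 2 := by field_simp
      _ < 0 := div_neg_of_neg_of_pos h1 (by positivity)
  have hM := critM_neg_of_coeffD_nonpos hz0 hz hy hd.le
  -- `Q(u) - Q(1/g)` is `u - 1/g` times the mean of the slopes of `Q` at the two points.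
  have : critQ z y = (coeffD z y * (1 / barrier z y) ^ 2 + 4 * coeffC z y * (1 / barrier z y)
      + 2 * coeffB z y) + (ratio z y - 1 / barrier z y)
        * (critM z y + (coeffD z y * (1 / barrier z y) + 2 * coeffC z y)) := by
    rw [critQ, critM]; ring
  rw [this]
  nlinarith [mul_nonneg (sub_nonneg.2 hu) (by linarith : 0 ≤ -(critM z y
    + (coeffD z y * (1 / barrier z y) + 2 * coeffC z y)))]

theorem eventually_pos_left_of_hasDerivAt_neg {f : ℝ → ℝ} {f' a : ℝ} (hf : HasDerivAt f f' a)
    (ha : f a = 0) (hf' : f' < 0) : ∀ᶠ s in 𝓝[<] a, 0 < f s := by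
  have h := (hasDerivAt_iff_tendsto_slope_left_right.1 hf).1.eventually_lt_const hf'
  filter_upwards [h, self_mem_nhdsWithin] with s hs hsa
  have hsa : s < a := hsa
  rw [slope_def_field, ha, sub_zero] at hs
  by_contra! hfs
  exact absurd hs (not_lt.2 (div_nonneg_of_nonpos hfs (by linarith)))

/-- A function `f` on `(0, ∞)`, negative near `0`, has positive derivative at each of its zeros,
provided that its derivative there has the strict sign of a continuous function `M` and that `f`
is negative wherever `M` vanishes. Indeed, at a zero with negative derivative `f` would be positive
just before; at the start of this interval of positivity `M` would be positive, so `M` would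
vanish inside it. -/
theorem deriv_pos_of_zero {f f' M : ℝ → ℝ} (hf : ∀ y, 0 < y → HasDerivAt f (f' y) y)
    (hM : ContinuousOn M (Ioi 0)) (h0 : ∀ᶠ y in 𝓝[>] 0, f y < 0)
    (hMf : ∀ y, 0 < y → M y = 0 → f y < 0) (hsign : ∀ y, 0 < y → f y = 0 → 0 < f' y * M y)
    {y : ℝ} (hy : 0 < y) (hfy : f y = 0) : 0 < f' y := by
  have hcont : ContinuousOn f (Ioi 0) := fun s hs => (hf s hs).continuousAt.continuousWithinAt
  by_contra! hneg
  have hs := hsign y hy hfy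
  have hneg' : f' y < 0 := hneg.lt_of_ne (by rintro h; simp [h] at hs)
  have hMy : M y < 0 := by
    by_contra! h
    nlinarith
  obtain ⟨a, ha, hfa⟩ : ∃ a ∈ Ioo 0 y, f a < 0 :=
    ((Filter.eventually_mem_set.2 (Ioo_mem_nhdsGT hy)).and h0).exists
  obtain ⟨b, hb, hbpos⟩ : ∃ b ∈ Ioo a y, ∀ s ∈ Ico b y, 0 < f s := by
    have := eventually_pos_left_of_hasDerivAt_neg (hf y hy) hfy hneg'
    obtain ⟨l, hl, hlb⟩ := (mem_nhdsLT_iff_exists_Ioo_subset' ha.2).1 this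
    have hm : max l a < y := max_lt hl ha.2
    refine ⟨(max l a + y) / 2, ⟨?_, by linarith⟩, fun s hs => hlb ⟨?_, hs.2⟩⟩
    · linarith [le_max_right l a]
    · linarith [le_max_left l a, hs.1]
  have hab : Icc a b ⊆ Ioi 0 := fun s hs => ha.1.trans_le hs.1
  -- the last zero `t` of `f` before `y`
  obtain ⟨t, ⟨ht, htle⟩, htmax⟩ : ∃ t, IsGreatest (Icc a b ∩ f ⁻¹' Iic 0) t := by
    refine IsCompact.exists_isGreatest ?_ ⟨a, ⟨le_rfl, hb.1.le⟩, hfa.le⟩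
    exact isCompact_Icc.of_isClosed_subset
      ((hcont.mono hab).preimage_isClosed_of_isClosed isClosed_Icc isClosed_Iic)
      inter_subset_left
  have ht0 : 0 < t := hab ht
  have htb : t < b := ht.2.lt_of_ne (by
    rintro rfl
    exact absurd (hbpos t ⟨le_rfl, hb.2⟩) (not_lt.2 htle))
  have hpos : ∀ s ∈ Ioo t y, 0 < f s := by
    intro s hs
    rcases lt_or_ge s b with h | h
    · by_contra! hn
      exact absurd (htmax ⟨⟨ht.1.trans hs.1.le, h.le⟩, hn⟩) (not_le.2 hs.1)
    · exact hbpos s ⟨h, hs.2⟩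
  have hty : t < y := htb.trans hb.2
  have hft : f t = 0 := by
    refine le_antisymm htle (ge_of_tendsto (x := 𝓝[>] t)
      ((hf t ht0).continuousAt.tendsto.mono_left nhdsWithin_le_nhds) ?_)
    filter_upwards [Ioo_mem_nhdsGT hty] with s hs using (hpos s hs).le
  have hft' : 0 < f' t := by
    have hst := hsign t ht0 hft
    by_contra! h
    have h' : f' t < 0 := h.lt_of_ne (by rintro h; simp [h] at hst)
    have hev := (hasDerivAt_iff_tendsto_slope_left_right.1 (hf t ht0)).2.eventually_lt_const h'
    obtain ⟨s, hs, hst⟩ := (hev.and (Filter.eventually_mem_set.2 (Ioo_mem_nhdsGT hty))).exists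
    rw [slope_def_field, hft, sub_zero] at hs
    exact absurd hs (not_lt.2 (div_nonneg (hpos s hst).le (by linarith [hst.1])))
  have hMt : 0 < M t := (pos_iff_pos_of_mul_pos (hsign t ht0 hft)).1 hft'
  obtain ⟨s, hs, hMs⟩ : ∃ s ∈ Icc t y, M s = 0 :=
    intermediate_value_Icc' hty.le (hM.mono fun s hs => ht0.trans_le hs.1) ⟨hMy.le, hMt.le⟩
  have hs1 : t ≠ s := by rintro rfl; exact hMt.ne' hMs
  have hs2 : s ≠ y := by rintro rfl; exact hMy.ne hMs
  have hs' : s ∈ Ioo t y := ⟨hs.1.lt_of_ne hs1, hs.2.lt_of_ne hs2⟩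
  exact lt_asymm (hpos s hs') (hMf s (ht0.trans hs'.1) hMs)

theorem deriv_halfH_pos_of_zero {z y : ℝ} (hz0 : 0 ≤ z) (hz : z ≤ 1 / 2) (hy : 0 < y)
    (hH : halfH z y = 0) : 0 < critR z y / y ^ 7 := by
  have h := abs_lt_abs_one hz0 hz
  refine deriv_pos_of_zero (fun y hy => hasDerivAt_halfH h hy) (critM_continuousOn h) ?_ ?_ ?_
    hy hH
  · filter_upwards [eventually_critQ_neg hz0 hz, self_mem_nhdsWithin] with s hs hs0
    exact (halfH_neg_iff h hs0).2 hs
  · intro s hs hM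
    exact (halfH_neg_iff h hs).2 (critQ_neg_of_critM_eq_zero hz0 hz hs hM)
  · intro s hs hs0
    rw [div_mul_eq_mul_div]
    exact div_pos (critR_mul_critM_pos hz0 hz hs ((halfH_eq_zero_iff h hs).1 hs0))
      (by positivity)

/-! ### Local maxima of `j_z` -/

theorem tendsto_ratio {z : ℝ} (h : |z| < |(1 : ℝ)|) : Tendsto (ratio z) (𝓝[>] 0) (𝓝 (1 / 3)) := by
  have hlim : Tendsto (fun s : ℝ => s ^ 2 / (s ^ 2 - 2 * z * s + 1 ^ 2) / (↑(3 : ℕ) * s ^ (3 - 1)))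
      (𝓝[>] 0) (𝓝 (1 / 3)) := by
    have hc : ContinuousAt (fun s : ℝ => 1 / (3 * (s ^ 2 - 2 * z * s + 1))) 0 :=
      ContinuousAt.div (by fun_prop) (by fun_prop) (by norm_num)
    have := hc.tendsto.mono_left (nhdsWithin_le_nhds (s := Ioi 0))
    norm_num at this
    refine Tendsto.congr' ?_ (this.trans (by norm_num))
    filter_upwards [self_mem_nhdsWithin] with s hs
    have hs0 : s ≠ 0 := ne_of_gt hs
    have hq := (quad_one_pos h s).ne'
    rw [one_pow]
    field_simp
    norm_num
    ring
  refine HasDerivAt.lhopital_zero_nhdsGT (.of_forall fun s => hasDerivAt_tortoise h s)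
    (.of_forall fun s => hasDerivAt_pow 3 s) ?_ ?_ ?_ hlim
  · filter_upwards [self_mem_nhdsWithin] with s hs
    have hs0 : (0 : ℝ) < s := hs
    positivity
  · have := (continuous_tortoise h).continuousAt.tendsto.mono_left
      (nhdsWithin_le_nhds (a := (0 : ℝ)) (s := Ioi 0))
    rwa [tortoise_zero] at this
  · have : ContinuousAt (fun s : ℝ => s ^ 3) 0 := by fun_prop
    have := this.tendsto.mono_left (nhdsWithin_le_nhds (s := Ioi 0))
    simpa using this

theorem continuousWithinAt_j_zero {z : ℝ} (h : |z| < |(1 : ℝ)|) :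
    ContinuousWithinAt (j z) (Ici 0) 0 := by
  rw [← continuousWithinAt_Ioi_iff_Ici, ContinuousWithinAt]
  have hid : Tendsto (fun y : ℝ => y) (𝓝[>] 0) (𝓝 0) := tendsto_id.mono_left nhdsWithin_le_nhds
  have hq : Tendsto (fun y : ℝ => y ^ 2 - 2 * z * y + 1) (𝓝[>] 0) (𝓝 1) := by
    have : ContinuousAt (fun y : ℝ => y ^ 2 - 2 * z * y + 1) 0 := by fun_prop
    simpa [Function.comp_def] using this.tendsto.comp hid
  have hc : Tendsto (coeffC z) (𝓝[>] 0) (𝓝 6) := by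
    have h0 : coeffC z 0 = 6 := by simp [coeffC]
    exact h0 ▸ ((continuous_coeffC z).tendsto 0).mono_left nhdsWithin_le_nhds
  have hb : Tendsto (coeffB z) (𝓝[>] 0) (𝓝 (-1)) := by
    have h0 : coeffB z 0 = -1 := by simp [coeffB]
    exact h0 ▸ ((continuous_coeffB z).tendsto 0).mono_left nhdsWithin_le_nhds
  have hu := tendsto_ratio h
  have H := ((hq.const_mul 2).mul (hu.pow 2)).mul ((hc.mul hu).add hb)
  have hj0 : j z 0 = 2 * 1 * (1 / 3) ^ 2 * (6 * (1 / 3) + -1) := by norm_num [j]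
  rw [hj0]
  refine H.congr' ?_
  filter_upwards [self_mem_nhdsWithin] with y hy
  exact (j_eq_ratio (ne_of_gt hy)).symm

theorem isLocalMaxOn_j_zero {z : ℝ} (hz0 : 0 ≤ z) (hz : z ≤ 1 / 2) :
    IsLocalMaxOn (j z) (Ici 0) 0 := by
  have h := abs_lt_abs_one hz0 hz
  obtain ⟨ε, hε, hneg⟩ := mem_nhdsGT_iff_exists_Ioo_subset.1 (eventually_critQ_neg hz0 hz)
  have hε : 0 < ε := hε
  have hanti : AntitoneOn (j z) (Ico 0 ε) := by
    refine antitoneOn_of_deriv_nonpos (convex_Ico _ _) ?_ ?_ ?_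
    · intro y hy
      rcases hy.1.eq_or_lt with rfl | hy0
      · exact (continuousWithinAt_j_zero h).mono Ico_subset_Ici_self
      · exact (hasDerivAt_j h hy0).continuousAt.continuousWithinAt
    · intro y hy
      rw [interior_Ico] at hy
      exact (hasDerivAt_j h hy.1).differentiableAt.differentiableWithinAt
    · intro y hy
      rw [interior_Ico] at hy
      rw [(hasDerivAt_j h hy.1).deriv]
      have hQ : critQ z y < 0 := hneg hy
      have hu := ratio_pos h hy.1
      exact div_nonpos_of_nonpos_of_nonneg
        (mul_nonpos_of_nonneg_of_nonpos (by positivity) hQ.le) hy.1.le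
  have hmem : Ico 0 ε ∈ 𝓝[≥] (0 : ℝ) := Ico_mem_nhdsGE hε
  filter_upwards [hmem] with y hy
  exact hanti ⟨le_rfl, hε⟩ hy hy.1

theorem not_isLocalMax_j {z y : ℝ} (hz0 : 0 ≤ z) (hz : z ≤ 1 / 2) (hy : 0 < y) :
    ¬ IsLocalMax (j z) y := by
  intro hmax
  have h := abs_lt_abs_one hz0 hz
  have hcrit := hmax.hasDerivAt_eq_zero (hasDerivAt_j h hy)
  have hQ : critQ z y = 0 := by
    have := (ratio_pos h hy).ne'
    simpa [hy.ne', this] using hcrit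
  have hH := (halfH_eq_zero_iff h hy).2 hQ
  have hH' := deriv_halfH_pos_of_zero hz0 hz hy hH
  have hright : ∀ᶠ s in 𝓝[>] y, 0 < critQ z s := by
    have hev := (hasDerivAt_iff_tendsto_slope_left_right.1
      (hasDerivAt_halfH h hy)).2.eventually_const_lt hH'
    filter_upwards [hev, self_mem_nhdsWithin] with s hs hys
    have hys : y < s := hys
    rw [slope_def_field, hH, sub_zero, div_pos_iff_of_pos_right (by linarith)] at hs
    exact (halfH_pos_iff h (hy.trans hys)).1 hs
  obtain ⟨ε, hε, hpos⟩ := mem_nhdsGT_iff_exists_Ioo_subset.1 hright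
  have hmono : StrictMonoOn (j z) (Ico y ε) := by
    refine strictMonoOn_of_deriv_pos (convex_Ico _ _) ?_ ?_
    · intro s hs
      exact (hasDerivAt_j h (hy.trans_le hs.1)).continuousAt.continuousWithinAt
    · intro s hs
      rw [interior_Ico] at hs
      have hs0 := hy.trans hs.1
      rw [(hasDerivAt_j h hs0).deriv]
      have hQ : 0 < critQ z s := hpos hs
      have hu := ratio_pos h hs0
      positivity
  have hle : ∀ᶠ s in 𝓝[>] y, j z s ≤ j z y := nhdsWithin_le_nhds hmax
  obtain ⟨s, hs, hsε⟩ := (hle.and (Filter.eventually_mem_set.2 (Ioo_mem_nhdsGT hε))).exists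
  exact absurd (hmono ⟨le_rfl, hε⟩ ⟨hsε.1.le, hsε.2⟩ hsε.1) (not_lt.2 hs)

theorem isLocalMaxOn_j_iff {z y : ℝ} (hz0 : 0 ≤ z) (hz : z ≤ 1 / 2) (hy : 0 ≤ y) :
    IsLocalMaxOn (j z) (Ici 0) y ↔ y = 0 := by
  refine ⟨fun hmax => ?_, ?_⟩
  · by_contra hne
    have hy0 : 0 < y := lt_of_le_of_ne' hy hne
    exact not_isLocalMax_j hz0 hz hy0 (hmax.isLocalMax (Ici_mem_nhds hy0))
  · rintro rfl
    exact isLocalMaxOn_j_zero hz0 hz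

/-! ### The supremum of `j_z` -/

theorem tortoise_le {z y : ℝ} (hz0 : 0 ≤ z) (hz : z ≤ 1 / 2) (hy : 0 ≤ y) :
    tortoise z 1 y ≤ 4 / 3 * y := by
  have h := abs_lt_abs_one hz0 hz
  have hder : ∀ s, HasDerivAt (fun s => 4 / 3 * s - tortoise z 1 s)
      (4 / 3 * 1 - s ^ 2 / (s ^ 2 - 2 * z * s + 1 ^ 2)) s := fun s =>
    ((hasDerivAt_id s).const_mul _).sub (hasDerivAt_tortoise h s)
  have hmono : MonotoneOn (fun s => 4 / 3 * s - tortoise z 1 s) (Ici 0) := by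
    refine monotoneOn_of_deriv_nonneg (convex_Ici _)
      (fun s _ => (hder s).continuousAt.continuousWithinAt)
      (fun s _ => (hder s).differentiableAt.differentiableWithinAt) ?_
    intro s hs
    rw [interior_Ici] at hs
    have hs : 0 < s := hs
    rw [(hder s).deriv, sub_nonneg, div_le_iff₀ (quad_pos h s)]
    nlinarith [sq_nonneg (s - 2), mul_nonneg hs.le (sub_nonneg.2 hz)]
  have := hmono (mem_Ici.2 le_rfl) (mem_Ici.2 hy) hy
  simp [tortoise_zero] at this
  exact this

theorem tendsto_j_atTop {z : ℝ} (hz0 : 0 ≤ z) (hz : z ≤ 1 / 2) :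
    Tendsto (j z) atTop (𝓝 0) := by
  have h := abs_lt_abs_one hz0 hz
  have hi : Tendsto (fun y : ℝ => y⁻¹) atTop (𝓝 0) := tendsto_inv_atTop_zero
  have hA : Tendsto (fun y : ℝ => -6 * z * y⁻¹ + (8 + 28 * z ^ 2) * y⁻¹ ^ 2
      - (52 * z + 32 * z ^ 3) * y⁻¹ ^ 3 + (20 + 76 * z ^ 2) * y⁻¹ ^ 4 - 54 * z * y⁻¹ ^ 5
      + 12 * y⁻¹ ^ 6) atTop (𝓝 0) := by
    have : ContinuousAt (fun i : ℝ => -6 * z * i + (8 + 28 * z ^ 2) * i ^ 2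
      - (52 * z + 32 * z ^ 3) * i ^ 3 + (20 + 76 * z ^ 2) * i ^ 4 - 54 * z * i ^ 5
      + 12 * i ^ 6) 0 := by fun_prop
    simpa [Function.comp_def] using this.tendsto.comp hi
  have hB : Tendsto (fun y : ℝ => 2 * z * y⁻¹ - (2 + 4 * z ^ 2) * y⁻¹ ^ 2 + 6 * z * y⁻¹ ^ 3
      - 2 * y⁻¹ ^ 4) atTop (𝓝 0) := by
    have : ContinuousAt (fun i : ℝ => 2 * z * i - (2 + 4 * z ^ 2) * i ^ 2 + 6 * z * i ^ 3
      - 2 * i ^ 4) 0 := by fun_prop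
    simpa [Function.comp_def] using this.tendsto.comp hi
  have hbdd : ∀ n : ℕ, IsBoundedUnder (· ≤ ·) atTop
      ((‖·‖) ∘ fun y : ℝ => (tortoise z 1 y / y) ^ n) := by
    intro n
    refine isBoundedUnder_of_eventually_le (a := (4 / 3) ^ n) ?_
    filter_upwards [eventually_gt_atTop 0] with y hy
    have hT : 0 < tortoise z 1 y := (tortoise_bijOn h).mapsTo hy
    simp only [Function.comp_apply, norm_pow]
    refine pow_le_pow_left₀ (norm_nonneg _) ?_ n
    rw [Real.norm_of_nonneg (by positivity), div_le_iff₀ hy]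
    exact tortoise_le hz0 hz hy.le
  have H := (hA.zero_mul_isBoundedUnder_le (hbdd 3)).add (hB.zero_mul_isBoundedUnder_le (hbdd 2))
  rw [add_zero] at H
  refine H.congr' ?_
  filter_upwards [eventually_gt_atTop 0] with y hy
  rw [j, if_neg hy.ne', w]
  field_simp

/-- Since `0` is the only local maximum of `j_z` on `[0, ∞)` and `j_z` tends to `0 < j_z(0)` at
infinity, `0` is the global maximum. -/
theorem j_le {z y : ℝ} (hz0 : 0 ≤ z) (hz : z ≤ 1 / 2) (hy : 0 ≤ y) : j z y ≤ 2 / 9 := by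
  have h := abs_lt_abs_one hz0 hz
  have hj0 : j z 0 = 2 / 9 := if_pos rfl
  have hcont : ContinuousOn (j z) (Ici 0) := by
    intro s hs
    rcases (mem_Ici.1 hs).eq_or_lt with rfl | hs0
    · exact continuousWithinAt_j_zero h
    · exact (hasDerivAt_j h hs0).continuousAt.continuousWithinAt
  obtain ⟨x, hx, hmax⟩ : ∃ x ∈ Ici (0 : ℝ), IsMaxOn (j z) (Ici 0) x := by
    refine hcont.exists_isMaxOn' isClosed_Ici (mem_Ici.2 le_rfl) ?_
    have hev : ∀ᶠ s in atTop, j z s ≤ j z 0 := by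
      rw [hj0]
      exact ((tendsto_j_atTop hz0 hz).eventually_lt_const (by norm_num)).mono fun _ h => h.le
    obtain ⟨b, hb⟩ := eventually_atTop.1 hev
    have hK : (Icc 0 b)ᶜ ∈ cocompact ℝ := isCompact_Icc.compl_mem_cocompact
    filter_upwards [mem_inf_of_left hK, mem_inf_of_right (mem_principal_self _)] with s hs hs0
    refine hb s ?_
    by_contra! hsb
    exact hs ⟨hs0, hsb.le⟩
  have hx0 : x = 0 := (isLocalMaxOn_j_iff hz0 hz hx).1 hmax.localize
  rw [← hj0, ← hx0]
  exact hmax hy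

/-! ### Scaling to Reissner–Nordström -/

theorem tortoise_scale {m e y : ℝ} (hm : |m| < |e|) :
    tortoise m e (|e| * y) = |e| * tortoise (m / |e|) 1 y := by
  have he : |e| ≠ 0 := ((abs_nonneg m).trans_lt hm).ne'
  have hq : ∀ s : ℝ, s ^ 2 / (s ^ 2 - 2 * (m / |e|) * s + 1 ^ 2)
      = (|e| * s) ^ 2 / ((|e| * s) ^ 2 - 2 * m * (|e| * s) + e ^ 2) := by
    intro s
    rw [← sq_abs e, ← mul_div_mul_left _ _ (pow_ne_zero 2 he)]
    congr 1
    · ring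
    · field_simp
  simp only [tortoise, hq]
  rw [← smul_eq_mul (|e|) (∫ _ in _.._, _),
    intervalIntegral.smul_integral_comp_mul_left
      (fun s => s ^ 2 / (s ^ 2 - 2 * m * s + e ^ 2)) |e|, mul_zero]

/-- The potential as a rational function of the area radius. -/
theorem V_eq {m e r : ℝ} (hm : |m| < |e|) (hr : 0 < r) :
    V m e r = (2 * m * areaRadius m e r - 2 * e ^ 2)
      * (areaRadius m e r ^ 2 - 2 * m * areaRadius m e r + e ^ 2) / areaRadius m e r ^ 6 := by
  have hp := areaRadius_pos hm hr
  have hd := ((areaRadius_spec hm).1 r hr).2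
  have hα : HasDerivAt (alphaSq m e) (2 * m / areaRadius m e r ^ 2
      - 2 * e ^ 2 / areaRadius m e r ^ 3) (areaRadius m e r) := by
    have := (((hasDerivAt_const _ (2 * m)).div (hasDerivAt_id (areaRadius m e r))
      hp.ne').const_sub 1).add ((hasDerivAt_const _ (e ^ 2)).div
      (hasDerivAt_pow 2 (areaRadius m e r)) (by positivity))
    refine this.congr_deriv ?_
    simp only [id]
    field_simp
    push_cast
    ring
  have hdd : deriv (deriv (areaRadius m e)) r
      = (2 * m / areaRadius m e r ^ 2 - 2 * e ^ 2 / areaRadius m e r ^ 3)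
        * alphaSq m e (areaRadius m e r) := by
    refine ((hα.comp r hd).congr_of_eventuallyEq ?_).deriv
    filter_upwards [lt_mem_nhds hr] with s hs
    exact ((areaRadius_spec hm).1 s hs).2.deriv
  rw [V, hdd, alphaSq]
  field_simp

theorem hasDerivAt_mul_V {m e r : ℝ} (hm : |m| < |e|) (hr : 0 < r) :
    HasDerivAt (fun s => s * V m e s)
      (j (m / |e|) (areaRadius m e r / |e|) / r ^ 2) r := by
  have he : 0 < |e| := (abs_nonneg m).trans_lt hm
  have hp := areaRadius_pos hm hr
  have hd := ((areaRadius_spec hm).1 r hr).2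
  have hT : tortoise (m / |e|) 1 (areaRadius m e r / |e|) = r / |e| := by
    have := tortoise_scale (y := areaRadius m e r / |e|) hm
    rw [mul_div_cancel₀ _ he.ne', tortoise_areaRadius hm hr] at this
    rw [eq_div_iff he.ne', mul_comm, ← this]
  have hF := (((hd.const_mul (2 * m)).sub_const (2 * e ^ 2)).mul
    (((hd.pow 2).sub (hd.const_mul (2 * m))).add_const (e ^ 2))).div (hd.pow 6)
      (pow_ne_zero 6 hp.ne')
  refine (((hasDerivAt_id r).mul hF).congr_of_eventuallyEq ?_).congr_deriv ?_
  · filter_upwards [lt_mem_nhds hr] with s hs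
    rw [V_eq hm hs]
    rfl
  · rw [j, if_neg (by positivity), hT, w, ← sq_abs e]
    simp only [id, Pi.mul_apply, Pi.pow_apply, Pi.sub_apply, Pi.div_apply, alphaSq, ← sq_abs e]
    generalize areaRadius m e r = ρ at hp ⊢
    generalize |e| = E at he ⊢
    field_simp
    push_cast
    ring

end ReissnerNordstrom

open ReissnerNordstrom in
theorem mainTheorem4 :
    (∀ z : ℝ, 0 ≤ z → z ≤ 1 / 2 →
      ContinuousWithinAt (ReissnerNordstrom.j z) (Set.Ici 0) 0 ∧
      ∀ y : ℝ, 0 ≤ y → (IsLocalMaxOn (ReissnerNordstrom.j z) (Set.Ici 0) y ↔ y = 0)) ∧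
    (∀ m e : ℝ, 0 ≤ m → m < |e| → 2 * m ≤ |e| →
      (∀ r : ℝ, 0 < r → DifferentiableAt ℝ (fun s => s * ReissnerNordstrom.V m e s) r) ∧
      IsLUB ((fun r => r ^ 2 * deriv (fun s => s * ReissnerNordstrom.V m e s) r) '' Set.Ioi 0)
        (2 / 9) ∧
      sSup ((fun r => r ^ 2 * deriv (fun s => s * ReissnerNordstrom.V m e s) r) '' Set.Ioi 0)
        < 1 / 4) := by
  refine ⟨fun z hz0 hz => ⟨continuousWithinAt_j_zero (abs_lt_abs_one hz0 hz),
    fun y hy => isLocalMaxOn_j_iff hz0 hz hy⟩, fun m e hm0 hme hm2 => ?_⟩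
  have hm : |m| < |e| := by rwa [abs_of_nonneg hm0]
  have he : 0 < |e| := hm0.trans_lt hme
  have hz0 : 0 ≤ m / |e| := by positivity
  have hz : m / |e| ≤ 1 / 2 := by rw [div_le_iff₀ he]; linarith
  have h := abs_lt_abs_one hz0 hz
  have hval : ∀ r ∈ Set.Ioi (0 : ℝ), r ^ 2 * deriv (fun s => s * V m e s) r
      = j (m / |e|) (areaRadius m e r / |e|) := by
    intro r hr
    rw [(hasDerivAt_mul_V hm hr).deriv, mul_div_cancel₀ _ (pow_ne_zero 2 (ne_of_gt hr))]
  have hlub : IsLUB ((fun r => r ^ 2 * deriv (fun s => s * V m e s) r) '' Set.Ioi 0) (2 / 9) := by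
    refine ⟨?_, fun B hB => ?_⟩
    · rintro _ ⟨r, hr, rfl⟩
      simp only [hval r hr]
      exact j_le hz0 hz (div_nonneg (areaRadius_pos hm hr).le he.le)
    · -- every `y > 0` is `ρ(r) / |e|` for some `r`, and `j_z(y)` tends to `2 / 9` as `y → 0+`
      have hlim : Filter.Tendsto (j (m / |e|)) (nhdsWithin 0 (Set.Ioi 0)) (nhds (2 / 9)) := by
        have := (continuousWithinAt_j_zero h).mono Set.Ioi_subset_Ici_self
        rwa [ContinuousWithinAt, show j (m / |e|) 0 = 2 / 9 from if_pos rfl] at this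
      refine le_of_tendsto hlim ?_
      filter_upwards [self_mem_nhdsWithin] with y hy
      have hey : 0 < |e| * y := mul_pos he hy
      have hr := (tortoise_bijOn hm).mapsTo hey
      have := hB (Set.mem_image_of_mem _ hr)
      simp only [hval _ hr] at this
      rwa [areaRadius_tortoise hm hey, mul_div_cancel_left₀ _ he.ne'] at this
  refine ⟨fun r hr => (hasDerivAt_mul_V hm hr).differentiableAt, hlub, ?_⟩
  rw [hlub.csSup_eq ⟨_, Set.mem_image_of_mem _ (Set.mem_Ioi.2 one_pos)⟩]
  norm_num
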